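/- Let $k$ and $\alpha$ be integers with $0\le\alpha\le k$. For a finite set $A$ of integers write $-A=\{-a : a\in A\}$ and $$\Sigma_\alpha(A)=\Big\{\sum_{b\in B} b \;:\; B\subseteq A,\ |B|\ge\alpha\Big\},$$ where the empty sum is $0$. If $A$ is a set of $k$ integers such that $A\cap(-A)=\emptyset$, then $$|\Sigma_\alpha(A)|\ \ge\ \frac{k(k+1)}{2}-\frac{\alpha(\alpha+1)}{2}+1 .$$ This lower bound is optimal: for every $k$ and $\alpha$ with $0\le\alpha\le k$, the set $A=[1,k]=\{1,2,\dots,k\}$ (empty if $k=0$) consists of $k$ integers, satisfies $A\cap(-A)=\emptyset$, and $$|\Sigma_\alpha([1,k])|=\frac{k(k+1)}{2}-\frac{\alpha(\alpha+1)}{2}+1 .$$ -/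

import Mathlib

open scoped Pointwise

/-- `subsetSums α A` is the set `Σ_α(A)` of the sums of the elements of those subsets of `A` that
have at least `α` elements. -/
def subsetSums (α : ℕ) (A : Finset ℤ) : Finset ℤ :=
  (A.powerset.filter fun B => α ≤ B.card).image fun B => ∑ b ∈ B, b

/-! Complementation in `A` turns sums of at least `α` elements into sums of at most `m = k - α`. For
these, remove an element `x` of largest absolute value, positive after replacing `A` by `-A` if
needed. If `Q` has the largest admissible sum in the rest `D`, then changing `Q` by inserting `x`,
and possibly dropping or adding one element, gives at least `min m (|D| + 1)` sums beyond that
maximum (`card_boundedSubsetSums_insert`). Adding these gains gives the bound. For `[1, k]` all sums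
lie in an interval of exactly that size. -/

/-- The set of the sums of the elements of those subsets of `A` that have at most `m` elements. -/
def boundedSubsetSums (m : ℕ) (A : Finset ℤ) : Finset ℤ :=
  (A.powerset.filter fun B => B.card ≤ m).image fun B => ∑ b ∈ B, b

theorem mem_subsetSums {α : ℕ} {A : Finset ℤ} {z : ℤ} :
    z ∈ subsetSums α A ↔ ∃ B ⊆ A, α ≤ B.card ∧ ∑ b ∈ B, b = z := by
  simp [subsetSums, and_assoc]

theorem mem_boundedSubsetSums {m : ℕ} {A : Finset ℤ} {z : ℤ} :
    z ∈ boundedSubsetSums m A ↔ ∃ B ⊆ A, B.card ≤ m ∧ ∑ b ∈ B, b = z := by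
  simp [boundedSubsetSums, and_assoc]

theorem boundedSubsetSums_mono {m : ℕ} {A B : Finset ℤ} (h : A ⊆ B) :
    boundedSubsetSums m A ⊆ boundedSubsetSums m B := by
  intro z
  simp only [mem_boundedSubsetSums]
  rintro ⟨C, hC, hc, rfl⟩
  exact ⟨C, hC.trans h, hc, rfl⟩

theorem neg_mem_boundedSubsetSums_neg {m : ℕ} {A : Finset ℤ} {z : ℤ}
    (hz : z ∈ boundedSubsetSums m A) : -z ∈ boundedSubsetSums m (-A) := by
  simp only [mem_boundedSubsetSums] at hz ⊢
  obtain ⟨B, hB, hc, rfl⟩ := hz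
  refine ⟨-B, Finset.neg_subset_neg hB, by simpa using hc, ?_⟩
  rw [Finset.sum_neg_index, Finset.sum_neg_distrib]

theorem card_boundedSubsetSums_neg (m : ℕ) (A : Finset ℤ) :
    (boundedSubsetSums m (-A)).card = (boundedSubsetSums m A).card := by
  refine le_antisymm ?_ ?_
  · refine Finset.card_le_card_of_injOn (fun z => -z) (fun z hz => ?_) neg_injective.injOn
    simpa using neg_mem_boundedSubsetSums_neg hz
  · exact Finset.card_le_card_of_injOn (fun z => -z)
      (fun z hz => neg_mem_boundedSubsetSums_neg hz) neg_injective.injOn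

/-- Complementation inside `A`: sums of large subsets are reflections of sums of small ones. -/
theorem card_boundedSubsetSums_le_card_subsetSums {α : ℕ} {A : Finset ℤ}
    (hα : α ≤ A.card) :
    (boundedSubsetSums (A.card - α) A).card ≤ (subsetSums α A).card := by
  refine Finset.card_le_card_of_injOn (fun z => ∑ a ∈ A, a - z) (fun z hz => ?_)
    sub_right_injective.injOn
  obtain ⟨B, hB, hc, rfl⟩ := mem_boundedSubsetSums.1 hz
  refine mem_subsetSums.2 ⟨A \ B, Finset.sdiff_subset, ?_, ?_⟩
  · rw [Finset.card_sdiff_of_subset hB]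
    omega
  · rw [← Finset.sum_sdiff hB]
    ring

/-- Adjoining an element `x` dominating `D` in absolute value creates many new bounded sums, all
of them larger than the sums over `D`. -/
theorem card_boundedSubsetSums_insert {m : ℕ} {D : Finset ℤ} {x : ℤ} (hx : ∀ d ∈ D, |d| < x)
    (hx0 : 0 < x) (hne : ∀ d ∈ D, ∀ e ∈ D, d + e ≠ 0) :
    (boundedSubsetSums m D).card + min m (D.card + 1) ≤
      (boundedSubsetSums m (insert x D)).card := by
  have hxD : x ∉ D := fun h => (lt_of_le_of_lt (le_abs_self x) (hx x h)).false
  obtain ⟨Q, hQ, hmax⟩ := Finset.exists_max_image (D.powerset.filter fun B => B.card ≤ m)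
    (fun B => ∑ b ∈ B, b) ⟨∅, by simp⟩
  simp only [Finset.mem_filter, Finset.mem_powerset] at hQ hmax
  obtain ⟨hQD, hQm⟩ := hQ
  -- Sums exceeding the maximum over `D` are automatically new.
  have key : ∀ N ⊆ boundedSubsetSums m (insert x D), (∀ z ∈ N, ∑ b ∈ Q, b < z) →
      (boundedSubsetSums m D).card + N.card ≤ (boundedSubsetSums m (insert x D)).card := by
    intro N hN hlt
    rw [← Finset.card_union_of_disjoint]
    · exact Finset.card_le_card
        (Finset.union_subset (boundedSubsetSums_mono (Finset.subset_insert _ _)) hN)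
    · rw [Finset.disjoint_left]
      intro z hz hzN
      obtain ⟨B, hB, hc, rfl⟩ := mem_boundedSubsetSums.1 hz
      exact ((hmax B ⟨hB, hc⟩).trans_lt (hlt _ hzN)).false
  have mem_of : ∀ C ⊆ D, C.card + 1 ≤ m →
      x + ∑ b ∈ C, b ∈ boundedSubsetSums m (insert x D) := fun C hC hc =>
    mem_boundedSubsetSums.2 ⟨insert x C, Finset.insert_subset_insert _ hC,
      (Finset.card_insert_le _ _).trans hc, Finset.sum_insert fun h => hxD (hC h)⟩
  have hrem : ∀ t ∈ Q, x + ∑ b ∈ Q, b + -t ∈ boundedSubsetSums m (insert x D) := by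
    intro t ht
    have h1 := Finset.card_erase_add_one ht
    have h2 := Finset.sum_erase_add Q (fun b => b) ht
    have h3 := mem_of (Q.erase t) ((Finset.erase_subset _ _).trans hQD) (by omega)
    rwa [← h2, add_assoc, add_assoc, add_neg_cancel, add_zero]
  have hinj : Function.Injective fun t : ℤ => x + ∑ b ∈ Q, b + t := add_right_injective _
  have hcardneg : (-Q).card = Q.card := Finset.card_neg Q
  have hzero : ∀ d ∈ D, d ≠ 0 := fun d hd h => hne d hd d hd (by omega)
  have hnegQ : ∀ z ∈ -Q, -z ∈ Q := fun z hz => Finset.mem_neg'.1 hz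
  -- The new sums are `x + ∑ Q + t`, above `∑ Q` since `|t| < x`. The room left below `m` decides
  -- which `t` are allowed: `-Q` (swap an element for `x`), then `0`, then `D \ Q`.
  obtain hm | hm : Q.card = m ∨ Q.card + 1 ≤ m := by omega
  · have h := key ((-Q).image fun t => x + ∑ b ∈ Q, b + t) ?_ ?_
    · rw [Finset.card_image_of_injective _ hinj, hcardneg] at h
      omega
    · rw [Finset.image_subset_iff]
      intro z hz
      simpa using hrem (-z) (hnegQ z hz)
    · rw [Finset.forall_mem_image]
      intro z hz
      have := abs_lt.1 (hx _ (hQD (hnegQ z hz)))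
      omega
  have h0 : (0 : ℤ) ∉ -Q := fun h => hzero _ (hQD (hnegQ 0 h)) neg_zero
  obtain hm' | hm' : Q.card + 1 = m ∨ Q.card + 2 ≤ m := by omega
  · have h := key ((insert 0 (-Q)).image fun t => x + ∑ b ∈ Q, b + t) ?_ ?_
    · rw [Finset.card_image_of_injective _ hinj, Finset.card_insert_of_notMem h0, hcardneg] at h
      omega
    · rw [Finset.image_subset_iff, Finset.forall_mem_insert]
      refine ⟨by simpa using mem_of Q hQD hm, fun z hz => ?_⟩
      simpa using hrem (-z) (hnegQ z hz)
    · rw [Finset.forall_mem_image, Finset.forall_mem_insert]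
      refine ⟨by omega, fun z hz => ?_⟩
      have := abs_lt.1 (hx _ (hQD (hnegQ z hz)))
      omega
  · have h := key ((insert 0 (-Q ∪ D \ Q)).image fun t => x + ∑ b ∈ Q, b + t) ?_ ?_
    · have h0' : (0 : ℤ) ∉ -Q ∪ D \ Q := by
        rw [Finset.mem_union, not_or]
        exact ⟨h0, fun h => hzero 0 (Finset.sdiff_subset h) rfl⟩
      -- Dropping and adding give different sums because `D` contains no opposite pair.
      have hdisj : Disjoint (-Q) (D \ Q) := by
        rw [Finset.disjoint_left]
        intro z hz hzD
        exact hne _ (hQD (hnegQ z hz)) z (Finset.sdiff_subset hzD) (by omega)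
      have := Finset.card_sdiff_add_card_eq_card hQD
      rw [Finset.card_image_of_injective _ hinj, Finset.card_insert_of_notMem h0',
        Finset.card_union_of_disjoint hdisj, hcardneg] at h
      omega
    · rw [Finset.image_subset_iff, Finset.forall_mem_insert]
      refine ⟨by simpa using mem_of Q hQD hm, fun z hz => ?_⟩
      obtain hz | hz := Finset.mem_union.1 hz
      · simpa using hrem (-z) (hnegQ z hz)
      · rw [Finset.mem_sdiff] at hz
        have h3 := mem_of (insert z Q) (Finset.insert_subset hz.1 hQD)
          (by rw [Finset.card_insert_of_notMem hz.2]; omega)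
        rwa [Finset.sum_insert hz.2, add_comm z, ← add_assoc] at h3
    · rw [Finset.forall_mem_image, Finset.forall_mem_insert]
      refine ⟨by omega, fun z hz => ?_⟩
      obtain hz | hz := Finset.mem_union.1 hz
      · have := abs_lt.1 (hx _ (hQD (hnegQ z hz)))
        omega
      · have := abs_lt.1 (hx _ (Finset.sdiff_subset hz))
        omega

/-- The strict inequality accounts for the empty sum. -/
theorem sum_min_lt_card_boundedSubsetSums (m n : ℕ) :
    ∀ A : Finset ℤ, A.card = n → (∀ a ∈ A, ∀ b ∈ A, a + b ≠ 0) →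
      ∑ j ∈ Finset.range n, min m (j + 1) < (boundedSubsetSums m A).card := by
  induction n with
  | zero =>
    intro A _ _
    rw [Finset.sum_range_zero, Finset.card_pos]
    exact ⟨0, mem_boundedSubsetSums.2 ⟨∅, by simp, by simp, by simp⟩⟩
  | succ n ih =>
    intro A hA hne
    obtain ⟨y, hy, hmax⟩ := Finset.exists_max_image A (fun a => |a|)
      (Finset.card_pos.1 (by omega))
    -- Stated for every `A` so that it also applies to `-A`.
    have pos_case : ∀ A : Finset ℤ, A.card = n + 1 → (∀ a ∈ A, ∀ b ∈ A, a + b ≠ 0) →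
        ∀ x ∈ A, 0 < x → (∀ a ∈ A, |a| ≤ x) →
        ∑ j ∈ Finset.range (n + 1), min m (j + 1) < (boundedSubsetSums m A).card := by
      intro A hA hne x hxA hx0 hmax
      have hcard : (A.erase x).card = n := by rw [Finset.card_erase_of_mem hxA]; omega
      have hne' : ∀ a ∈ A.erase x, ∀ b ∈ A.erase x, a + b ≠ 0 := fun a ha b hb =>
        hne a (Finset.mem_of_mem_erase ha) b (Finset.mem_of_mem_erase hb)
      have h1 := ih (A.erase x) hcard hne'
      have h2 := card_boundedSubsetSums_insert (m := m) (D := A.erase x) (x := x) ?_ hx0 hne'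
      · rw [Finset.insert_erase hxA, hcard] at h2
        rw [Finset.sum_range_succ]
        omega
      · intro d hd
        rw [Finset.mem_erase] at hd
        have h3 := abs_le.1 (hmax d hd.2)
        have h4 := hne d hd.2 x hxA
        rw [abs_lt]
        omega
    have hy0 : y ≠ 0 := fun h => hne y hy y hy (by omega)
    obtain h | h := lt_or_gt_of_ne hy0
    · rw [← card_boundedSubsetSums_neg]
      refine pos_case (-A) (by rwa [Finset.card_neg]) (fun a ha b hb hab => ?_) (-y)
        (by simpa using hy) (by omega) (fun a ha => ?_)
      · exact hne _ (Finset.mem_neg'.1 ha) _ (Finset.mem_neg'.1 hb) (by omega)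
      · have := hmax _ (Finset.mem_neg'.1 ha)
        rwa [abs_neg, abs_of_neg h] at this
    · refine pos_case A hA hne y hy h (fun a ha => ?_)
      have := hmax a ha
      rwa [abs_of_pos h] at this

/-- The first `m` terms are `1, …, m`; the other `α` all equal `m`. -/
theorem two_mul_sum_min (m α : ℕ) :
    2 * ∑ j ∈ Finset.range (m + α), min m (j + 1) + α * (α + 1) = (m + α) * (m + α + 1) := by
  have small : ∀ n ≤ m, 2 * ∑ j ∈ Finset.range n, min m (j + 1) = n * (n + 1) := by
    intro n
    induction n with
    | zero => simp
    | succ n ih =>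
      intro hn
      rw [Finset.sum_range_succ, mul_add, ih (by omega), min_eq_right hn]
      ring
  induction α with
  | zero => simpa using small m le_rfl
  | succ α ih =>
    rw [← add_assoc, Finset.sum_range_succ, min_eq_left (by omega)]
    linarith

theorem le_card_subsetSums {α : ℕ} {A : Finset ℤ} (hA : A ∩ (-A) = ∅) (hα : α ≤ A.card) :
    A.card * (A.card + 1) + 2 ≤ 2 * (subsetSums α A).card + α * (α + 1) := by
  have h1 := sum_min_lt_card_boundedSubsetSums (A.card - α) A.card A rfl (fun a ha b hb hab => by
    have h : b ∈ A ∩ (-A) :=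
      Finset.mem_inter.2 ⟨hb, Finset.mem_neg'.2 (by rwa [← eq_neg_of_add_eq_zero_left hab])⟩
    simp [hA] at h)
  have h2 := card_boundedSubsetSums_le_card_subsetSums hα
  have h3 := two_mul_sum_min (A.card - α) α
  rw [Nat.sub_add_cancel hα] at h3
  omega

theorem card_mul_succ_le_two_mul_sum {k : ℕ} {B : Finset ℤ} (hB : B ⊆ Finset.Icc 1 (k : ℤ)) :
    (B.card : ℤ) * (B.card + 1) ≤ 2 * ∑ b ∈ B, b := by
  induction k generalizing B with
  | zero =>
    obtain rfl : B = ∅ := by simpa using hB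
    simp
  | succ k ih =>
    have hsub : B.erase ((k : ℤ) + 1) ⊆ Finset.Icc 1 (k : ℤ) := by
      intro z hz
      rw [Finset.mem_erase] at hz
      have := Finset.mem_Icc.1 (hB hz.2)
      rw [Finset.mem_Icc]
      push_cast at this
      omega
    have h := ih hsub
    by_cases hk : (k : ℤ) + 1 ∈ B
    · have h1 := Finset.card_erase_add_one hk
      have h2 := Finset.sum_erase_add B (fun b => b) hk
      have h3 := Finset.card_le_card hsub
      rw [Int.card_Icc] at h3
      rw [← h1, ← h2]
      push_cast
      have h4 : ((B.erase ((k : ℤ) + 1)).card : ℤ) ≤ k := by omega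
      linarith
    · rwa [Finset.erase_eq_of_notMem hk] at h

theorem two_mul_sum_Icc_one (k : ℕ) : 2 * ∑ b ∈ Finset.Icc (1 : ℤ) k, b = k * (k + 1) := by
  induction k with
  | zero => simp
  | succ k ih =>
    have h : Finset.Icc (1 : ℤ) ((k + 1 : ℕ) : ℤ) =
        insert ((k : ℤ) + 1) (Finset.Icc (1 : ℤ) k) := by
      ext z
      simp only [Finset.mem_insert, Finset.mem_Icc]
      omega
    rw [h, Finset.sum_insert (by simp), mul_add, ih]
    push_cast
    ring

/-- The sums lie between `1 + ⋯ + α` and `1 + ⋯ + k`. -/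
theorem card_subsetSums_Icc_le {k α : ℕ} (hα : α ≤ k) :
    2 * (subsetSums α (Finset.Icc (1 : ℤ) k)).card + α * (α + 1) ≤ k * (k + 1) + 2 := by
  have hsub : subsetSums α (Finset.Icc (1 : ℤ) k) ⊆
      Finset.Icc (∑ b ∈ Finset.Icc (1 : ℤ) α, b) (∑ b ∈ Finset.Icc (1 : ℤ) k, b) := by
    intro z hz
    obtain ⟨B, hB, hc, rfl⟩ := mem_subsetSums.1 hz
    rw [Finset.mem_Icc]
    constructor
    · have h1 := card_mul_succ_le_two_mul_sum hB
      have h2 := two_mul_sum_Icc_one α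
      have h3 : (α : ℤ) ≤ B.card := by exact_mod_cast hc
      nlinarith
    · refine Finset.sum_le_sum_of_subset_of_nonneg hB fun b hb _ => ?_
      have := Finset.mem_Icc.1 hb
      omega
  have h1 := Finset.card_le_card hsub
  rw [Int.card_Icc] at h1
  have h2 := two_mul_sum_Icc_one α
  have h3 := two_mul_sum_Icc_one k
  have h4 : α * (α + 1) ≤ k * (k + 1) := Nat.mul_le_mul hα (by omega)
  zify at h4 ⊢
  omega

theorem Icc_one_inter_neg (k : ℕ) : Finset.Icc (1 : ℤ) k ∩ (-Finset.Icc (1 : ℤ) k) = ∅ := by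
  ext z
  simp only [Finset.mem_inter, Finset.mem_neg', Finset.mem_Icc, Finset.notMem_empty, iff_false]
  omega

theorem theorem2p1 :
    (∀ (k α : ℕ) (A : Finset ℤ), A.card = k → A ∩ (-A) = ∅ → α ≤ k →
      (k : ℚ) * (k + 1) / 2 - (α : ℚ) * (α + 1) / 2 + 1 ≤ ((subsetSums α A).card : ℚ)) ∧
    (∀ k α : ℕ, α ≤ k →
      (Finset.Icc (1 : ℤ) k).card = k ∧
      Finset.Icc (1 : ℤ) k ∩ (-Finset.Icc (1 : ℤ) k) = ∅ ∧
      ((subsetSums α (Finset.Icc (1 : ℤ) k)).card : ℚ) =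
        (k : ℚ) * (k + 1) / 2 - (α : ℚ) * (α + 1) / 2 + 1) := by
  have lower : ∀ (k α : ℕ) (A : Finset ℤ), A.card = k → A ∩ (-A) = ∅ → α ≤ k →
      (k : ℚ) * (k + 1) / 2 - (α : ℚ) * (α + 1) / 2 + 1 ≤ ((subsetSums α A).card : ℚ) := by
    rintro k α A rfl hA hα
    have h : (A.card : ℚ) * (A.card + 1) + 2 ≤ 2 * (subsetSums α A).card + α * (α + 1) := by
      exact_mod_cast le_card_subsetSums hA hα
    linarith
  refine ⟨lower, fun k α hα => ?_⟩
  have hcard : (Finset.Icc (1 : ℤ) k).card = k := by simp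
  refine ⟨hcard, Icc_one_inter_neg k,
    le_antisymm ?_ (lower k α _ hcard (Icc_one_inter_neg k) hα)⟩
  have h : 2 * ((subsetSums α (Finset.Icc (1 : ℤ) k)).card : ℚ) + α * (α + 1) ≤
      k * (k + 1) + 2 := by
    exact_mod_cast card_subsetSums_Icc_le hα
  linarith
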